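/- For real numbers $P,Q>0$ let $$\mathcal M(P,Q)=\Big\{\alpha\in\mathbb R:\ \Big|\alpha-\frac aq\Big|\le\frac1{qP}\ \text{ for some integers } a,q \text{ with } 1\le q\le Q,\ (a,q)=1\Big\},\qquad \mathfrak m(P,Q)=[0,1]\setminus\mathcal M(P,Q)$$ be the major and minor arcs, and write $e(x)=e^{2\pi i x}$, and $\mu$ for the Möbius function. For every $\varepsilon>0$ there is a constant $C=C(\varepsilon)>0$ such that the following holds. Let $k\ge 2$ be an integer, put $\gamma=4^{1-k}$, let $f$ be a real polynomial of degree $k$ with leading coefficient $\alpha$, and let $N\ge 1$ be a real number. If $\alpha\in\mathfrak m(N,N^{1/2})$ (that is, $P=N$ and $Q=N^{1/2}$), then $$\Big|\sum_{1\le n\le N}\mu^2(n)\,e(f(n))\Big|\le C\,N^{1+\varepsilon-\gamma/2}.$$ -/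

import Mathlib

/-- The additive character `e(x) = exp(2πix)`. -/
noncomputable def expE (x : ℝ) : ℂ := Complex.exp (2 * Real.pi * Complex.I * x)

/-- The major arcs with parameters `P`, `Q`: all real `α` having a rational approximation
`|α - a/q| ≤ 1/(qP)` in lowest terms with `1 ≤ q ≤ Q`. -/
def majorArc (P Q : ℝ) : Set ℝ :=
  {α | ∃ (a : ℤ) (q : ℕ), 1 ≤ q ∧ (q : ℝ) ≤ Q ∧ IsCoprime a (q : ℤ) ∧
    |α - (a : ℝ) / (q : ℝ)| ≤ 1 / ((q : ℝ) * P)}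

/-- The minor arcs with parameters `P`, `Q`. -/
def minorArc (P Q : ℝ) : Set ℝ := Set.Icc 0 1 \ majorArc P Q

/-- The exponent `γ = 4^(1-k)`. -/
noncomputable def weylGamma (k : ℕ) : ℝ := (4 : ℝ) ^ (1 - (k : ℝ))

/-- The sum of `μ²(n) e(f(n))` over positive integers `n ≤ N`. -/
noncomputable def squarefreeExpSum (f : Polynomial ℝ) (N : ℝ) : ℂ :=
  ∑ n ∈ Finset.Icc 1 ⌊N⌋₊,
    (((ArithmeticFunction.moebius n) ^ 2 : ℤ) : ℂ) * expE (f.eval (n : ℝ))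

/-! Since `μ²(n) = ∑_{d² ∣ n} μ(d)`, the sum equals `∑_d μ(d) ∑_{m ≤ N/d²} e(f(d²m))`
(`squarefreeExpSum_eq`). With `K = 2^(k-1)`, so that `γ = 1/K²`, it is cut at `d = Y = N^(γ/2)`. The
trivial bound makes the tail `O(N/Y)`, which is already the target.

For `d ≤ Y` the inner sum is a Weyl sum with leading coefficient `α d^(2k)`. Dirichlet's theorem and
the minor arc condition give `a/q` close to `α` with `N^(1/2) ≤ q ≤ N`
(`exists_rat_approx_of_mem_minorArc`). This approximation to `α` itself serves every `d`: in Weyl's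
inequality the factor `d^(2k)` only lengthens the sum of `min(M, 1/(2‖αl‖))` over `l`
(`weyl_inequality_divisor_form`), and `M d² ≤ N` compensates. Each inner sum is `O(N^(1-1/(2K)+ε))`
(`exponential_sum_square_progression_le`), and summing over `d ≤ Y` is affordable because `γ ≤
1/(2K)`.

This constant depends on `k`. For `k` large in terms of `ε`, however, `γ/2 ≤ ε` and the trivial
bound suffices, so only finitely many `k` matter. -/

/-! ### The additive character and linear exponential sums -/

lemma expE_add (x y : ℝ) : expE (x + y) = expE x * expE y := by
  rw [expE, expE, expE, ← Complex.exp_add]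
  push_cast
  ring_nf

lemma norm_expE (x : ℝ) : ‖expE x‖ = 1 := by
  have h : 2 * (Real.pi : ℂ) * Complex.I * x = ((2 * Real.pi * x : ℝ) : ℂ) * Complex.I := by
    push_cast; ring
  rw [expE, h, Complex.norm_exp_ofReal_mul_I]

lemma expE_intCast (n : ℤ) : expE n = 1 := by
  rw [expE, Complex.exp_eq_one_iff]
  exact ⟨n, by push_cast; ring⟩

lemma expE_neg (x : ℝ) : expE (-x) = (starRingEnd ℂ) (expE x) := by
  rw [expE, expE, ← Complex.exp_conj]
  simp only [map_mul, Complex.conj_ofReal, Complex.conj_I, map_ofNat, Complex.ofReal_neg]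
  ring_nf

/-- The distance from `x` to the nearest integer. -/
noncomputable def nearestIntDist (x : ℝ) : ℝ := |x - round x|

lemma nearestIntDist_le (x : ℝ) (z : ℤ) : nearestIntDist x ≤ |x - z| := round_le x z

lemma nearestIntDist_neg (x : ℝ) : nearestIntDist (-x) = nearestIntDist x := by
  apply le_antisymm
  · refine (nearestIntDist_le (-x) (-round x)).trans_eq ?_
    rw [nearestIntDist, ← abs_neg]
    push_cast
    ring_nf
  · refine (nearestIntDist_le x (-round (-x))).trans_eq ?_
    rw [nearestIntDist, ← abs_neg]
    push_cast
    ring_nf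

/-- After reduction to `|y| ≤ 1/2`, this is `|e(y) - 1| = 2|sin πy|` with Jordan's inequality. -/
lemma four_mul_nearestIntDist_le (x : ℝ) : 4 * nearestIntDist x ≤ ‖expE x - 1‖ := by
  set y := x - round x with hy
  have h1 : expE x = expE y := by
    have : x = y + (round x : ℤ) := by rw [hy]; ring
    conv_lhs => rw [this]
    rw [expE_add, expE_intCast, mul_one]
  have h2 : 2 * (Real.pi : ℂ) * Complex.I * y = Complex.I * ((2 * Real.pi * y : ℝ) : ℂ) := by
    push_cast; ring
  rw [h1, expE, h2, Complex.norm_exp_I_mul_ofReal_sub_one, norm_mul, Real.norm_eq_abs,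
    Real.norm_eq_abs, abs_two, nearestIntDist, ← hy]
  have h3 : |y| ≤ 1 / 2 := abs_sub_round x
  have hpi := Real.pi_pos
  have h4 := Real.mul_abs_le_abs_sin (x := Real.pi * y) (by
    rw [abs_mul, abs_of_pos hpi]; nlinarith)
  rw [abs_mul, abs_of_pos hpi] at h4
  have h5 : 2 / Real.pi * (Real.pi * |y|) = 2 * |y| := by field_simp
  rw [h5] at h4
  have h6 : 2 * Real.pi * y / 2 = Real.pi * y := by ring
  rw [h6]
  linarith

/-- A junk-free form of `min M (1 / (2‖x‖))`, where `‖x‖` is the distance to the integers. -/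
noncomputable def weylKernel (M x : ℝ) : ℝ := M / max 1 (2 * M * nearestIntDist x)

lemma weylKernel_nonneg {M : ℝ} (hM : 0 ≤ M) (x : ℝ) : 0 ≤ weylKernel M x :=
  div_nonneg hM (zero_le_one.trans (le_max_left _ _))

lemma weylKernel_le {M : ℝ} (hM : 0 ≤ M) (x : ℝ) : weylKernel M x ≤ M :=
  div_le_self hM (le_max_left _ _)

lemma weylKernel_neg (M x : ℝ) : weylKernel M (-x) = weylKernel M x := by
  rw [weylKernel, weylKernel, nearestIntDist_neg]

lemma weylKernel_le_inv {M : ℝ} (hM : 0 < M) {x t : ℝ} (ht : 0 < t) (h : t ≤ nearestIntDist x) :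
    weylKernel M x ≤ 1 / (2 * t) := by
  rw [weylKernel, div_le_div_iff₀ (lt_max_of_lt_left one_pos) (by positivity)]
  have : 2 * M * nearestIntDist x ≤ max 1 (2 * M * nearestIntDist x) := le_max_right _ _
  nlinarith

lemma le_weylKernel {M x s : ℝ} (h1 : s ≤ M) (hM : 0 ≤ M)
    (h2 : s * (2 * nearestIntDist x) ≤ 1) : s ≤ weylKernel M x := by
  rw [weylKernel, le_div_iff₀ (lt_max_of_lt_left one_pos)]
  rcases max_cases 1 (2 * M * nearestIntDist x) with h | h
  · rw [h.1]; linarith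
  · rw [h.1]; nlinarith

lemma sum_Ico_expE_mul {a b : ℤ} (hab : a ≤ b) (β c : ℝ) :
    (∑ n ∈ Finset.Ico a b, expE (β * n + c)) * (expE β - 1) =
      expE (β * b + c) - expE (β * a + c) := by
  induction b, hab using Int.leInduction with
  | base => simp
  | succ b hb ih =>
    have : Finset.Ico a (b + 1) = insert b (Finset.Ico a b) := by
      ext x; simp; omega
    rw [this, Finset.sum_insert (by simp), add_mul, ih]
    have : β * ((b + 1 : ℤ) : ℝ) + c = β * b + c + β := by push_cast; ring
    rw [this, expE_add (β * b + c)]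
    ring

lemma norm_sum_expE_linear_le {a b : ℤ} {M : ℝ} (hM : 0 ≤ M) (h : (b : ℝ) - a ≤ M) (β c : ℝ) :
    ‖∑ n ∈ Finset.Ico a b, expE (β * n + c)‖ ≤ weylKernel M β := by
  rcases lt_or_ge b a with hab | hab
  · rw [Finset.Ico_eq_empty (by omega)]
    simpa using weylKernel_nonneg hM β
  apply le_weylKernel _ hM
  · have h1 := congrArg norm (sum_Ico_expE_mul hab β c)
    rw [norm_mul] at h1
    have h2 := norm_sub_le (expE (β * b + c)) (expE (β * a + c))
    rw [norm_expE, norm_expE] at h2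
    have h3 := mul_le_mul_of_nonneg_left (four_mul_nearestIntDist_le β)
      (norm_nonneg (∑ n ∈ Finset.Ico a b, expE (β * n + c)))
    linarith
  · refine (norm_sum_le _ _).trans (le_trans (le_of_eq ?_) h)
    simp only [norm_expE, Finset.sum_const, Int.card_Ico, nsmul_eq_mul, mul_one]
    rw [← Int.cast_natCast, Int.toNat_of_nonneg (by omega)]
    push_cast; ring

/-! ### Weyl differencing -/

/-- Weyl's differencing identity as an inequality. -/
lemma sq_norm_sum_le_sum_shifts (u : ℤ → ℂ) (M : ℕ) {a b : ℤ} (h : b - a ≤ M) :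
    ‖∑ n ∈ Finset.Ico a b, u n‖ ^ 2 ≤ ∑ d ∈ Finset.Ioo (-(M : ℤ)) M,
      ‖∑ n ∈ Finset.Ico (max a (a - d)) (min b (b - d)), u (n + d) * (starRingEnd ℂ) (u n)‖ := by
  have key : (∑ n ∈ Finset.Ico a b, u n) * (starRingEnd ℂ) (∑ n ∈ Finset.Ico a b, u n) =
      ∑ d ∈ Finset.Ioo (-(M : ℤ)) M,
        ∑ n ∈ Finset.Ico (max a (a - d)) (min b (b - d)), u (n + d) * (starRingEnd ℂ) (u n) := by
    rw [map_sum, Finset.sum_mul_sum, ← Finset.sum_product', Finset.sum_sigma']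
    refine Finset.sum_bij' (fun p _ => ⟨p.1 - p.2, p.2⟩) (fun p _ => (p.2 + p.1, p.2))
      ?_ ?_ ?_ ?_ ?_
    · intro p hp
      simp only [Finset.mem_product, Finset.mem_Ico, Finset.mem_sigma, Finset.mem_Ioo] at hp ⊢
      omega
    · intro p hp
      simp only [Finset.mem_product, Finset.mem_Ico, Finset.mem_sigma, Finset.mem_Ioo] at hp ⊢
      omega
    · intro p _; simp
    · intro p _; simp
    · intro p _; simp
  have h2 : ‖∑ n ∈ Finset.Ico a b, u n‖ ^ 2 =
      ‖(∑ n ∈ Finset.Ico a b, u n) * (starRingEnd ℂ) (∑ n ∈ Finset.Ico a b, u n)‖ := by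
    rw [norm_mul, RCLike.norm_conj, sq]
  rw [h2, key]
  exact norm_sum_le _ _

lemma natDegree_le_and_coeff_taylor_sub (f : Polynomial ℝ) (j : ℕ) (hf : f.natDegree ≤ j + 1) (h : ℝ) :
    (Polynomial.taylor h f - f).natDegree ≤ j ∧
      (Polynomial.taylor h f - f).coeff j = (j + 1) * h * f.coeff (j + 1) := by
  have hco : ∀ n, j ≤ n → (Polynomial.taylor h f - f).coeff n =
      (n + 1) * h * f.coeff (n + 1) := by
    intro n hn
    -- The `n`-th Taylor coefficient at `h` is a polynomial in `h` of degree at most 1, and its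
    -- constant term cancels against `f`.
    have hd : (Polynomial.hasseDeriv n f).natDegree < 2 := by
      have := Polynomial.natDegree_hasseDeriv_le f n
      omega
    rw [Polynomial.coeff_sub, Polynomial.taylor_coeff, Polynomial.eval_eq_sum_range' hd]
    simp only [Finset.sum_range_succ, Finset.sum_range_zero, Polynomial.hasseDeriv_coeff]
    simp [add_comm 1 n]
    ring
  refine ⟨?_, hco j le_rfl⟩
  rw [Polynomial.natDegree_le_iff_coeff_eq_zero]
  intro n hn
  rw [hco n hn.le, Polynomial.coeff_eq_zero_of_natDegree_lt (by omega), mul_zero]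

/-- The `j`-fold iterated average of `weylKernel` that arises from Weyl differencing. -/
noncomputable def weylIter (M : ℕ) : ℕ → ℝ → ℝ
  | 0, β => weylKernel M β
  | j + 1, β => ∑ h ∈ Finset.Ioo (-(M : ℤ)) M, weylIter M j (β * h)

/-- Induction on `j`: square the sum, raise to the power `2^j` by the power mean inequality over the
shifts `d`, and apply the case `j` to the differenced polynomial. The natural subtraction in the
exponent is genuine because `j + 1 ≤ 2^j`. -/
lemma weyl_differencing (M j : ℕ) (f : Polynomial ℝ) (hf : f.natDegree ≤ j + 1) (a b : ℤ)
    (hab : b - a ≤ M) :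
    ‖∑ n ∈ Finset.Ico a b, expE (f.eval (n : ℝ))‖ ^ 2 ^ j ≤
      (2 * M : ℝ) ^ (2 ^ j - (j + 1)) * weylIter M j ((j + 1).factorial * f.coeff (j + 1)) := by
  induction j generalizing f a b with
  | zero =>
    have := norm_sum_expE_linear_le (M := M) (a := a) (b := b) (Nat.cast_nonneg M)
      (by exact_mod_cast hab) (f.coeff 1) (f.coeff 0)
    have h2 : ∀ n : ℤ, f.eval (n : ℝ) = f.coeff 1 * n + f.coeff 0 := by
      intro n
      rw [Polynomial.eval_eq_sum_range' (n := 2) (by omega)]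
      simp [Finset.sum_range_succ]
      ring
    simpa [weylIter, h2] using this
  | succ j ih =>
    have h1 := sq_norm_sum_le_sum_shifts (fun n : ℤ => expE (f.eval (n : ℝ))) M hab
    have hjp : j + 1 ≤ 2 ^ j := Nat.lt_two_pow_self
    have hM0 : (0 : ℝ) ≤ 2 * M := by positivity
    set F : ℤ → ℝ := fun d => ‖∑ n ∈ Finset.Ico (max a (a - d)) (min b (b - d)),
      expE (f.eval ((n + d : ℤ) : ℝ)) * (starRingEnd ℂ) (expE (f.eval (n : ℝ)))‖ with hF
    have hs : (2 ^ j - 1) + 1 = 2 ^ j := by omega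
    calc ‖∑ n ∈ Finset.Ico a b, expE (f.eval (n : ℝ))‖ ^ 2 ^ (j + 1)
        = (‖∑ n ∈ Finset.Ico a b, expE (f.eval (n : ℝ))‖ ^ 2) ^ 2 ^ j := by
          rw [← pow_mul, pow_succ 2 j, mul_comm]
      _ ≤ (∑ d ∈ Finset.Ioo (-(M : ℤ)) M, F d) ^ ((2 ^ j - 1) + 1) := by
          rw [hs]
          exact pow_le_pow_left₀ (by positivity) h1 _
      _ ≤ _ := pow_sum_le_card_mul_sum_pow (fun _ _ => norm_nonneg _) _
      _ ≤ (2 * M : ℝ) ^ (2 ^ j - 1) * ∑ d ∈ Finset.Ioo (-(M : ℤ)) M,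
          ((2 * M : ℝ) ^ (2 ^ j - (j + 1)) *
            weylIter M j (((j + 2).factorial * f.coeff (j + 2)) * d)) := by
          gcongr with d hd
          · simp only [Int.card_Ioo]
            have : ((M : ℤ) - (-M) - 1).toNat ≤ 2 * M := by omega
            exact_mod_cast this
          · have h3 := natDegree_le_and_coeff_taylor_sub f (j + 1) hf d
            have h4 := ih (Polynomial.taylor (d : ℝ) f - f) h3.1 (max a (a - d))
              (min b (b - d)) (by omega)
            rw [h3.2] at h4
            rw [hs]
            refine le_trans (le_of_eq ?_) (h4.trans (le_of_eq ?_))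
            · congr 2
              refine Finset.sum_congr rfl fun n _ => ?_
              rw [← expE_neg, ← expE_add, Polynomial.eval_sub, Polynomial.taylor_eval]
              push_cast
              ring_nf
            · congr 2
              rw [Nat.factorial_succ (j + 1)]
              push_cast
              ring
      _ = _ := by
          rw [← Finset.mul_sum, ← mul_assoc, ← pow_add, weylIter]
          congr 2
          rw [pow_succ]
          omega

/-! ### Collapsing the iterated kernel to one sum -/

lemma sum_Ioo_neg_le {F : ℤ → ℝ} {G : ℕ → ℝ} (h1 : ∀ h : ℕ, F h ≤ G h)
    (h2 : ∀ h : ℕ, F (-h) ≤ G h) (m : ℕ) :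
    ∑ h ∈ Finset.Ioo (-((m + 1 : ℕ) : ℤ)) ((m + 1 : ℕ) : ℤ), F h ≤
      F 0 + 2 * ∑ h ∈ Finset.Icc 1 m, G h := by
  induction m with
  | zero =>
    have : Finset.Ioo (-((0 + 1 : ℕ) : ℤ)) ((0 + 1 : ℕ) : ℤ) = {0} := by
      ext x; simp; omega
    rw [this]; simp
  | succ m ih =>
    have : Finset.Ioo (-((m + 1 + 1 : ℕ) : ℤ)) ((m + 1 + 1 : ℕ) : ℤ) =
        insert ((m + 1 : ℕ) : ℤ) (insert (-((m + 1 : ℕ) : ℤ))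
          (Finset.Ioo (-((m + 1 : ℕ) : ℤ)) ((m + 1 : ℕ) : ℤ))) := by
      ext x; simp; omega
    rw [this, Finset.sum_insert (by simp; omega), Finset.sum_insert (by simp),
      Finset.sum_Icc_succ_top (by omega)]
    have := h1 (m + 1)
    have := h2 (m + 1)
    linarith

lemma sum_sum_mul_le_sum_divisors {φ : ℕ → ℝ} (hφ : ∀ n, 0 ≤ φ n) (A B : ℕ) :
    ∑ h ∈ Finset.Icc 1 A, ∑ l ∈ Finset.Icc 1 B, φ (h * l) ≤
      ∑ n ∈ Finset.Icc 1 (A * B), (n.divisors.card : ℝ) * φ n := by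
  rw [← Finset.sum_product', ← Finset.sum_fiberwise_of_maps_to
    (t := Finset.Icc 1 (A * B)) (g := fun p : ℕ × ℕ => p.1 * p.2)]
  · refine Finset.sum_le_sum fun n hn => ?_
    have : ∀ p ∈ (Finset.Icc 1 A ×ˢ Finset.Icc 1 B).filter (fun p : ℕ × ℕ => p.1 * p.2 = n),
        φ (p.1 * p.2) = φ n := fun p hp => by rw [(Finset.mem_filter.1 hp).2]
    rw [Finset.sum_congr rfl this, Finset.sum_const, nsmul_eq_mul]
    refine mul_le_mul_of_nonneg_right ?_ (hφ n)
    norm_cast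
    refine Finset.card_le_card_of_injOn Prod.fst ?_ ?_
    · intro p hp
      simp only [Finset.coe_filter, Set.mem_ofPred_eq, Finset.mem_Icc] at hp hn
      simp only [Finset.mem_coe, Nat.mem_divisors]
      exact ⟨⟨_, hp.2.symm⟩, by omega⟩
    · rintro ⟨x, y⟩ hp ⟨x', y'⟩ hp' hxx
      simp only [Finset.coe_filter, Set.mem_ofPred_eq, Finset.mem_product, Finset.mem_Icc]
        at hp hp' hxx
      subst hxx
      rw [← hp'.2] at hp
      simpa using Nat.eq_of_mul_eq_mul_left (by omega) hp.2
  · intro p hp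
    simp only [Finset.mem_product, Finset.mem_Icc] at hp ⊢
    exact ⟨Nat.mul_pos hp.1.1 hp.2.1, Nat.mul_le_mul hp.1.2 hp.2.2⟩

lemma weylIter_le_trivial (M j : ℕ) (β : ℝ) : weylIter M j β ≤ (2 * M : ℝ) ^ j * M := by
  induction j generalizing β with
  | zero => simpa [weylIter] using weylKernel_le (Nat.cast_nonneg M) β
  | succ j ih =>
    rw [weylIter]
    refine (Finset.sum_le_card_nsmul _ (fun h : ℤ => weylIter M j (β * h)) _
      fun h _ => ih (β * h)).trans ?_
    have hcard : ((Finset.Ioo (-(M : ℤ)) M).card : ℝ) ≤ 2 * M := by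
      rw [Int.card_Ioo]
      exact_mod_cast (by omega : ((M : ℤ) - (-M) - 1).toNat ≤ 2 * M)
    have := mul_le_mul_of_nonneg_right hcard (show 0 ≤ (2 * M : ℝ) ^ j * M by positivity)
    rw [nsmul_eq_mul, pow_succ]
    linarith

/-- At each level `h = 0` gives no cancellation and gets the trivial bound; these losses add up to
`j(2M)^j`. For `h ≠ 0` the product `hl` becomes a single variable at the cost of a divisor count
`T`, and the two signs of `h` cost the factor 2. Keeping `J` fixed lets one `T` serve all levels. -/
lemma weylIter_le {M J : ℕ} (hM : 1 ≤ M) {T : ℝ}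
    (hT : ∀ l : ℕ, l ≠ 0 → l ≤ M ^ J → (l.divisors.card : ℝ) ≤ T) (j : ℕ) (hj : j ≤ J) (β : ℝ) :
    weylIter M j β ≤ j * (2 * M : ℝ) ^ j +
      (2 * T) ^ j * ∑ l ∈ Finset.Icc 1 (M ^ j), weylKernel M (β * l) := by
  have hT1 : 1 ≤ T := by simpa using hT 1 one_ne_zero (Nat.one_le_pow _ _ hM)
  have hMr : (1 : ℝ) ≤ M := by exact_mod_cast hM
  induction j generalizing β with
  | zero => simp [weylIter]
  | succ j ih =>
    obtain ⟨m, rfl⟩ : ∃ m, M = m + 1 := ⟨M - 1, by omega⟩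
    set M := m + 1 with hMm
    rw [weylIter]
    have h1 := sum_Ioo_neg_le (F := fun h : ℤ => weylIter M j (β * h))
      (G := fun h : ℕ => j * (2 * M : ℝ) ^ j +
        (2 * T) ^ j * ∑ l ∈ Finset.Icc 1 (M ^ j), weylKernel M (β * ((h * l : ℕ) : ℝ)))
      (fun h => (ih (by omega) _).trans_eq (by push_cast; simp only [mul_assoc]))
      (fun h => (ih (by omega) _).trans_eq (by
        push_cast
        congr 2
        refine Finset.sum_congr rfl fun l _ => ?_
        rw [← weylKernel_neg]
        ring_nf)) m
    refine h1.trans ?_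
    have h2 := weylIter_le_trivial M j (β * ((0 : ℤ) : ℝ))
    rw [Finset.sum_add_distrib, ← Finset.mul_sum _ _ ((2 * T) ^ j)]
    have h3 : ∑ h ∈ Finset.Icc 1 m, ∑ l ∈ Finset.Icc 1 (M ^ j),
        weylKernel M (β * ((h * l : ℕ) : ℝ)) ≤
        T * ∑ n ∈ Finset.Icc 1 (M ^ (j + 1)), weylKernel M (β * n) := by
      refine (sum_sum_mul_le_sum_divisors (φ := fun n => weylKernel M (β * (n : ℝ)))
        (fun n => weylKernel_nonneg (by positivity) _) m (M ^ j)).trans ?_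
      rw [Finset.mul_sum]
      have hle : m * M ^ j ≤ M ^ (j + 1) := by
        rw [pow_succ, mul_comm]; exact Nat.mul_le_mul_left _ (by omega)
      refine (Finset.sum_le_sum_of_subset_of_nonneg (Finset.Icc_subset_Icc_right hle)
        fun _ _ _ => mul_nonneg (by positivity) (weylKernel_nonneg (by positivity) _)).trans ?_
      refine Finset.sum_le_sum fun n hn => ?_
      rw [Finset.mem_Icc] at hn
      refine mul_le_mul_of_nonneg_right (hT n (by omega) (hn.2.trans ?_))
        (weylKernel_nonneg (by positivity) _)
      exact Nat.pow_le_pow_right hM hj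
    have h4 : ∑ h ∈ Finset.Icc 1 m, (j : ℝ) * (2 * M : ℝ) ^ j ≤ M * (j * (2 * M : ℝ) ^ j) := by
      rw [Finset.sum_const, nsmul_eq_mul, Nat.card_Icc]
      refine mul_le_mul_of_nonneg_right ?_ (by positivity)
      exact_mod_cast (by omega : m + 1 - 1 ≤ M)
    have h5 := mul_le_mul_of_nonneg_left h3 (show 0 ≤ (2 * T) ^ j by positivity)
    have h6 : 0 ≤ (2 * M : ℝ) ^ j * M := by positivity
    rw [pow_succ, pow_succ (2 * T)]
    push_cast at *
    linarith

/-! ### Summing the kernel using a rational approximation -/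

lemma min_le_abs_add_mul {s q w : ℤ} (hs0 : 0 ≤ s) (hsq : s < q) : min s (q - s) ≤ |s + q * w| := by
  rcases lt_or_ge w 0 with h | h
  · have : q * w ≤ -q := by nlinarith
    rw [abs_of_neg (by linarith)]
    exact (min_le_right _ _).trans (by linarith)
  · have : 0 ≤ q * w := by nlinarith
    rw [abs_of_nonneg (by linarith)]
    exact (min_le_left _ _).trans (by linarith)

lemma sum_residue_majorant_le (M : ℝ) (hM : 0 ≤ M) (q : ℕ) :
    ∑ u ∈ Finset.range (q + 1), (if u ≤ 2 then M else (q : ℝ) / (2 * ((u : ℝ) - 2))) ≤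
      3 * M + q / 2 * (1 + Real.log q) := by
  -- Lengthening the range to `q + 3` leaves exactly the harmonic sum up to `q` once `u = 0, 1, 2`
  -- are split off.
  have h1 : ∑ u ∈ Finset.range (q + 3), (if u ≤ 2 then M else (q : ℝ) / (2 * ((u : ℝ) - 2))) =
      3 * M + q / 2 * harmonic q := by
    rw [Finset.sum_range_succ', Finset.sum_range_succ', Finset.sum_range_succ', harmonic]
    push_cast
    rw [Finset.mul_sum]
    have : ∀ i ∈ Finset.range q, (q : ℝ) / (2 * ((i : ℝ) + 1 + 1 + 1 - 2)) = q / 2 * ((i : ℝ) + 1)⁻¹ := by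
      intro i _
      have : (i : ℝ) + 1 + 1 + 1 - 2 = i + 1 := by ring
      rw [this, div_mul_eq_div_div, div_eq_mul_inv _ ((i : ℝ) + 1)]
    rw [Finset.sum_congr rfl this]
    ring
  have h2 := harmonic_le_one_add_log q
  calc _ ≤ ∑ u ∈ Finset.range (q + 3), (if u ≤ 2 then M else (q : ℝ) / (2 * ((u : ℝ) - 2))) := by
        refine Finset.sum_le_sum_of_subset_of_nonneg (Finset.range_mono (by omega)) ?_
        intro u _ _
        split_ifs with h
        · exact hM
        · have : (2 : ℝ) ≤ u := by exact_mod_cast (by omega : 2 ≤ u)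
          exact div_nonneg (by positivity) (by linarith)
    _ = _ := h1
    _ ≤ _ := by gcongr

/-- For `l = l₀ + r`, `qαl` differs from the integer `ar + y` by at most 2: 1 from the floor and 1
from the approximation, as `r < q`. These integers run once through the residues mod `q`, so `‖αl‖ ≥
(u - 2)/q` with `u` the distance from the residue to `qℤ`; hence the threshold 2 in `G`. -/
lemma sum_weylKernel_block_le {α : ℝ} {a : ℤ} {q : ℕ} (hq : 1 ≤ q) (hc : IsCoprime a (q : ℤ))
    (hα : |α - a / q| ≤ 1 / (q : ℝ) ^ 2) {M : ℝ} (hM : 0 < M) (l₀ : ℕ) :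
    ∑ r ∈ Finset.range q, weylKernel M (α * ((l₀ + r : ℕ) : ℝ)) ≤
      6 * M + q * (1 + Real.log q) := by
  have hq0 : (0 : ℝ) < q := by exact_mod_cast hq
  have hqz : (0 : ℤ) < q := by exact_mod_cast hq
  set G : ℕ → ℝ := fun u => if u ≤ 2 then M else (q : ℝ) / (2 * ((u : ℝ) - 2)) with hG
  have hG0 : ∀ u, 0 ≤ G u := by
    intro u
    simp only [hG]
    split_ifs with h
    · exact hM.le
    · have : (2 : ℝ) ≤ u := by exact_mod_cast (by omega : 2 ≤ u)
      exact div_nonneg (by positivity) (by linarith)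
  set y : ℤ := ⌊α * l₀ * q⌋ with hy
  set s : ℕ → ℕ := fun r => ((a * r + y) % q).toNat with hs
  have hs0 : ∀ r, ((s r : ℕ) : ℤ) = (a * r + y) % q := fun r =>
    Int.toNat_of_nonneg (Int.emod_nonneg _ hqz.ne')
  have hslt : ∀ r, s r < q := fun r => by
    have := Int.emod_lt_of_pos (a * r + y) hqz
    rw [← hs0] at this
    exact_mod_cast this
  -- Bounding `G(min(s, q - s))` by `G(s) + G(q - s)` leaves two sums, each injective in the
  -- residue.
  have hmain : ∀ r ∈ Finset.range q,
      weylKernel M (α * ((l₀ + r : ℕ) : ℝ)) ≤ G (s r) + G (q - s r) := by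
    intro r hr
    rw [Finset.mem_range] at hr
    set x : ℝ := α * ((l₀ + r : ℕ) : ℝ) with hx
    set u : ℕ := min (s r) (q - s r) with hu
    have hdist : ((u : ℝ) - 2) / q ≤ nearestIntDist x := by
      set z := round x with hz
      set t := (a * r + y) / (q : ℤ) with ht
      have hdecomp : (a : ℝ) * r + y = s r + q * t := by
        have := Int.emod_add_mul_ediv (a * r + y) q
        rw [← hs0] at this
        exact_mod_cast this.symm
      have h1 : (u : ℝ) ≤ |(s r : ℝ) + q * ((t - z : ℤ) : ℝ)| := by
        have h := min_le_abs_add_mul (s := s r) (q := q) (w := t - z) (by positivity)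
          (by exact_mod_cast hslt r)
        have h' : (u : ℤ) = min (s r : ℤ) (q - s r) := by
          have := hslt r
          omega
        rw [← h'] at h
        exact_mod_cast h
      have h2 : |α * l₀ * q - y| ≤ 1 := by
        rw [abs_le]
        have := Int.floor_le (α * l₀ * q)
        have := Int.lt_floor_add_one (α * l₀ * q)
        constructor <;> linarith
      have h3 : |(r : ℝ) * q * (α - a / q)| ≤ 1 := by
        rw [abs_mul, abs_of_nonneg (by positivity)]
        calc (r : ℝ) * q * |α - a / q| ≤ q * q * (1 / (q : ℝ) ^ 2) := by gcongr
          _ = 1 := by field_simp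
      have h4 : (x - z) * q = (s r + q * ((t - z : ℤ) : ℝ)) +
          ((α * l₀ * q - y) + r * q * (α - a / q)) := by
        rw [hx]
        push_cast
        have : (r : ℝ) * q * (α - a / q) = r * q * α - r * a := by field_simp
        rw [this]
        linear_combination hdecomp
      rw [nearestIntDist, div_le_iff₀ hq0]
      have h5 : |x - z| * q = |(x - z) * q| := by rw [abs_mul, abs_of_pos hq0]
      rw [h5, h4]
      have h6 := abs_add_le (α * l₀ * q - y) (r * q * (α - a / q))
      have h7 := abs_sub_abs_le_abs_sub ((s r : ℝ) + q * ((t - z : ℤ) : ℝ))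
        (-((α * l₀ * q - y) + r * q * (α - a / q)))
      rw [abs_neg, sub_neg_eq_add] at h7
      linarith
    have hgu : weylKernel M x ≤ G u := by
      simp only [hG]
      split_ifs with h
      · exact weylKernel_le hM.le x
      · have h2u : (2 : ℝ) < u := by exact_mod_cast (by omega : 2 < u)
        refine (weylKernel_le_inv hM (div_pos (by linarith) hq0) hdist).trans_eq ?_
        have : (u : ℝ) - 2 ≠ 0 := by linarith
        field_simp
    rcases min_choice (s r) (q - s r) with h | h
    · rw [hu, h] at hgu
      linarith [hG0 (q - s r)]
    · rw [hu, h] at hgu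
      linarith [hG0 (s r)]
  have hinj : Set.InjOn s (Finset.range q) := by
    intro r hr r' hr' h
    simp only [Finset.coe_range, Set.mem_Iio] at hr hr'
    have h1 : (a * r + y) % q = (a * r' + y) % q := by rw [← hs0, ← hs0, h]
    have h2 : (q : ℤ) ∣ a * (r - r') := by
      have := Int.ModEq.dvd (n := q) (a := a * r' + y) (b := a * r + y) h1.symm
      convert this using 1; ring
    have h3 : (q : ℤ) ∣ r - r' := hc.symm.dvd_of_dvd_mul_left h2
    have h4 : (r : ℤ) - r' = 0 := by
      refine Int.eq_zero_of_abs_lt_dvd h3 ?_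
      rw [abs_lt]; omega
    omega
  have hsum := sum_residue_majorant_le M hM.le q
  have hA : ∑ v ∈ Finset.range q, G v ≤ 3 * M + q / 2 * (1 + Real.log q) :=
    (Finset.sum_le_sum_of_subset_of_nonneg (Finset.range_mono (by omega))
      fun u _ _ => hG0 u).trans hsum
  have hB : ∑ v ∈ Finset.range q, G (q - v) ≤ 3 * M + q / 2 * (1 + Real.log q) := by
    refine le_trans ?_ hsum
    have hinj' : Set.InjOn (fun v => q - v) (Finset.range q) := by
      intro v hv v' hv' h
      simp only [Finset.coe_range, Set.mem_Iio] at hv hv' h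
      omega
    rw [← Finset.sum_image (f := G) hinj']
    refine Finset.sum_le_sum_of_subset_of_nonneg ?_ fun u _ _ => hG0 u
    intro v hv
    simp only [Finset.mem_image, Finset.mem_range] at hv ⊢
    omega
  calc _ ≤ ∑ r ∈ Finset.range q, (G (s r) + G (q - s r)) := Finset.sum_le_sum hmain
    _ = ∑ v ∈ (Finset.range q).image s, (G v + G (q - v)) := by
        rw [Finset.sum_image (f := fun v => G v + G (q - v)) hinj]
    _ ≤ ∑ v ∈ Finset.range q, (G v + G (q - v)) := by
        refine Finset.sum_le_sum_of_subset_of_nonneg ?_ fun u _ _ => add_nonneg (hG0 _) (hG0 _)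
        intro v hv
        simp only [Finset.mem_image] at hv
        obtain ⟨r, -, rfl⟩ := hv
        exact Finset.mem_range.2 (hslt r)
    _ ≤ _ := by rw [Finset.sum_add_distrib]; linarith

lemma sum_weylKernel_le {α : ℝ} {a : ℤ} {q : ℕ} (hq : 1 ≤ q) (hc : IsCoprime a (q : ℤ))
    (hα : |α - a / q| ≤ 1 / (q : ℝ) ^ 2) {M : ℝ} (hM : 0 < M) (L : ℕ) :
    ∑ l ∈ Finset.Icc 1 L, weylKernel M (α * l) ≤
      ((L : ℝ) / q + 1) * (6 * M + q * (1 + Real.log q)) := by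
  have hblocks : ∀ n : ℕ, ∑ l ∈ Finset.range (n * q), weylKernel M (α * ((1 + l : ℕ) : ℝ)) ≤
      n * (6 * M + q * (1 + Real.log q)) := by
    intro n
    induction n with
    | zero => simp
    | succ n ih =>
      rw [add_mul, one_mul, Finset.sum_range_add]
      have := sum_weylKernel_block_le hq hc hα hM (1 + n * q)
      simp only [← add_assoc] at this ⊢
      push_cast at *
      linarith
  have hlog : 0 ≤ Real.log q := Real.log_natCast_nonneg q
  have h1 : ∑ l ∈ Finset.Icc 1 L, weylKernel M (α * l) =
      ∑ l ∈ Finset.range L, weylKernel M (α * ((1 + l : ℕ) : ℝ)) := by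
    rw [Finset.range_eq_Ico, ← Finset.Ico_add_one_right_eq_Icc,
      Finset.sum_Ico_add (fun l : ℕ => weylKernel M (α * (l : ℝ))) 0 L 1]
  rw [h1]
  have h2 : L ≤ (L / q + 1) * q := by
    have := Nat.div_add_mod L q
    have := Nat.mod_lt L hq
    nlinarith
  refine (Finset.sum_le_sum_of_subset_of_nonneg (Finset.range_mono h2)
    fun _ _ _ => weylKernel_nonneg hM.le _).trans ((hblocks _).trans ?_)
  refine mul_le_mul_of_nonneg_right ?_ (by positivity)
  push_cast
  gcongr
  exact Nat.cast_div_le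

/-! ### The divisor bound and the square-divisor identity -/

/-- Compare prime by prime. If `p^δ ≥ 2` then `a + 1 ≤ 2^a ≤ p^(δa)`; each of the boundedly many
smaller primes loses at most a factor `A`, by Bernoulli's inequality and `1 + c ≤ e^c = 2^δ`. -/
lemma card_divisors_le_rpow (δ : ℝ) (hδ : 0 < δ) :
    ∃ C : ℝ, 1 ≤ C ∧ ∀ n : ℕ, n ≠ 0 → (n.divisors.card : ℝ) ≤ C * (n : ℝ) ^ δ := by
  set c : ℝ := δ * Real.log 2 with hc
  have hc0 : 0 < c := mul_pos hδ (Real.log_pos one_lt_two)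
  set A : ℝ := 1 + 1 / c with hA
  have hA1 : 1 ≤ A := by have : 0 < 1 / c := by positivity
                         linarith
  obtain ⟨P, hP⟩ := exists_nat_ge ((2 : ℝ) ^ (1 / δ))
  have hlarge : ∀ p : ℕ, P ≤ p → (2 : ℝ) ≤ (p : ℝ) ^ δ := by
    intro p hp
    have h1 : (2 : ℝ) ^ (1 / δ) ≤ p := hP.trans (by exact_mod_cast hp)
    have h2 := Real.rpow_le_rpow (by positivity) h1 hδ.le
    rwa [← Real.rpow_mul (by norm_num), one_div_mul_cancel hδ.ne', Real.rpow_one] at h2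
  have hfac : ∀ p a : ℕ, p.Prime →
      ((a : ℝ) + 1) ≤ (if p < P then A else 1) * ((p : ℝ) ^ δ) ^ a := by
    intro p a hp
    split_ifs with h
    · have h2 : (1 : ℝ) + c ≤ (p : ℝ) ^ δ := by
        calc 1 + c ≤ Real.exp c := by linarith [Real.add_one_le_exp c]
          _ = (2 : ℝ) ^ δ := by rw [Real.rpow_def_of_pos two_pos, hc, mul_comm]
          _ ≤ _ := Real.rpow_le_rpow (by norm_num) (by exact_mod_cast hp.two_le) hδ.le
      have h3 := one_add_mul_le_pow (show (-2 : ℝ) ≤ c by linarith) a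
      have h4 : (1 + c) ^ a ≤ ((p : ℝ) ^ δ) ^ a := pow_le_pow_left₀ (by linarith) h2 a
      calc (a : ℝ) + 1 ≤ A * (1 + a * c) := by
            have : A * (1 + a * c) = 1 + 1 / c + a * c + a := by rw [hA]; field_simp; ring
            rw [this]
            have : 0 ≤ 1 / c := by positivity
            have : 0 ≤ a * c := by positivity
            linarith
        _ ≤ _ := mul_le_mul_of_nonneg_left (h3.trans h4) (by linarith)
    · rw [one_mul]
      calc (a : ℝ) + 1 ≤ 2 ^ a := by exact_mod_cast Nat.lt_two_pow_self (n := a)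
        _ ≤ _ := pow_le_pow_left₀ (by norm_num) (hlarge p (by omega)) a
  refine ⟨A ^ P, one_le_pow₀ hA1, fun n hn => ?_⟩
  have hn' : (n : ℝ) ^ δ = ∏ p ∈ n.primeFactors, ((p : ℝ) ^ δ) ^ n.factorization p := by
    conv_lhs => rw [← Nat.prod_factorization_pow_eq_self hn]
    rw [Finsupp.prod, Nat.cast_prod, ← Real.finsetProd_rpow _ _ (fun _ _ => by positivity)]
    refine Finset.prod_congr rfl fun p _ => ?_
    rw [Nat.cast_pow, ← Real.rpow_natCast, ← Real.rpow_natCast, ← Real.rpow_mul (by positivity),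
      ← Real.rpow_mul (by positivity), mul_comm]
  rw [Nat.card_divisors hn, hn']
  push_cast
  calc ∏ p ∈ n.primeFactors, ((n.factorization p : ℝ) + 1)
      ≤ ∏ p ∈ n.primeFactors,
          ((if p < P then A else 1) * ((p : ℝ) ^ δ) ^ n.factorization p) :=
        Finset.prod_le_prod (fun _ _ => by positivity)
          fun p hp => hfac p _ (Nat.prime_of_mem_primeFactors hp)
    _ = (∏ p ∈ n.primeFactors, if p < P then A else 1) *
          ∏ p ∈ n.primeFactors, ((p : ℝ) ^ δ) ^ n.factorization p := Finset.prod_mul_distrib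
    _ ≤ _ := by
      gcongr
      rw [← Finset.prod_filter, Finset.prod_const]
      refine pow_le_pow_right₀ hA1 ?_
      calc (n.primeFactors.filter (· < P)).card ≤ (Finset.range P).card :=
            Finset.card_le_card fun x hx => by simpa using (Finset.mem_filter.1 hx).2
        _ = P := Finset.card_range P

/-- Writing `n = b²a` with `a` squarefree, `d² ∣ n` holds exactly when `d ∣ b`, so the sum is `∑_{d
∣ b} μ(d)`, the indicator of `b = 1`. -/
lemma sum_moebius_sq_dvd {n N : ℕ} (hn : n ≠ 0) (hN : n ≤ N) :
    ∑ d ∈ (Finset.Icc 1 N).filter (fun d => d ^ 2 ∣ n), ArithmeticFunction.moebius d =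
      ArithmeticFunction.moebius n ^ 2 := by
  obtain ⟨a, b, hab, ha⟩ := Nat.sq_mul_squarefree n
  have hb : b ≠ 0 := by rintro rfl; simp at hab; omega
  have hset : (Finset.Icc 1 N).filter (fun d => d ^ 2 ∣ n) = b.divisors := by
    ext d
    simp only [Finset.mem_filter, Finset.mem_Icc, Nat.mem_divisors]
    constructor
    · rintro ⟨-, h⟩
      refine ⟨?_, hb⟩
      rw [← hab] at h
      obtain ⟨g, d', b', hg, hco, rfl, rfl⟩ := Nat.exists_coprime' (m := d) (n := b)
        (Nat.gcd_pos_of_pos_right d (Nat.pos_of_ne_zero hb))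
      have h2 : d' ^ 2 ∣ b' ^ 2 * a := by
        rw [mul_pow, mul_pow, mul_right_comm] at h
        exact Nat.dvd_of_mul_dvd_mul_right (by positivity) h
      have h3 : d' * d' ∣ a := sq d' ▸ (hco.pow 2 2).dvd_of_dvd_mul_left h2
      rw [Nat.isUnit_iff.1 (ha d' h3), one_mul]
      exact dvd_mul_left _ _
    · rintro ⟨h, -⟩
      have h2 : d ^ 2 ∣ n := hab ▸ (pow_dvd_pow_of_dvd h 2).mul_right a
      have h3 := Nat.le_of_dvd (Nat.pos_of_ne_zero hn) h2
      have h4 : 1 ≤ d := Nat.pos_of_dvd_of_pos h (Nat.pos_of_ne_zero hb)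
      exact ⟨⟨h4, by nlinarith⟩, h2⟩
  rw [hset, ArithmeticFunction.moebius_sq, ← ArithmeticFunction.coe_mul_zeta_apply,
    ArithmeticFunction.moebius_mul_coe_zeta, ArithmeticFunction.one_apply]
  have : b = 1 ↔ Squarefree n := by
    constructor
    · rintro rfl; rw [← hab]; simpa using ha
    · intro h
      have := h b (by rw [← hab, sq]; exact dvd_mul_right _ _)
      simpa using this
  simp only [this]

/-! ### Weyl's inequality along multiples of a square -/

/-- The approximation is to `α`, not to the leading coefficient `αc`. The points `(j+1)! c l` are
distinct integers up to `(j+1)! c M^j`, so by positivity the sum extends to all integers in that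
range. -/
lemma weyl_inequality_divisor_form {M j : ℕ} (hM : 1 ≤ M) {T : ℝ}
    (hT : ∀ l : ℕ, l ≠ 0 → l ≤ M ^ j → (l.divisors.card : ℝ) ≤ T) {f : Polynomial ℝ}
    (hf : f.natDegree ≤ j + 1) {α : ℝ} {c : ℕ} (hc : 0 < c) (hfc : f.coeff (j + 1) = α * c)
    {a : ℤ} {q : ℕ} (hq : 1 ≤ q) (haq : IsCoprime a (q : ℤ))
    (hα : |α - a / q| ≤ 1 / (q : ℝ) ^ 2) :
    ‖∑ m ∈ Finset.Icc 1 M, expE (f.eval (m : ℝ))‖ ^ 2 ^ j ≤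
      (2 * M : ℝ) ^ (2 ^ j - (j + 1)) * (j * (2 * M : ℝ) ^ j + (2 * T) ^ j *
        (((j + 1).factorial * c * (M : ℝ) ^ j / q + 1) * (6 * M + q * (1 + Real.log q)))) := by
  have hT1 : 1 ≤ T := by simpa using hT 1 one_ne_zero (Nat.one_le_pow _ _ hM)
  have h1 := weyl_differencing M j f hf 1 (M + 1) (by omega)
  have h2 : ∑ n ∈ Finset.Ico (1 : ℤ) (M + 1), expE (f.eval (n : ℝ)) =
      ∑ m ∈ Finset.Icc 1 M, expE (f.eval (m : ℝ)) := by
    refine (Finset.sum_bij (fun (m : ℕ) _ => (m : ℤ)) ?_ ?_ ?_ ?_).symm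
    · intro m hm
      simp only [Finset.mem_Icc, Finset.mem_Ico] at hm ⊢
      omega
    · intro m _ m' _ h
      exact_mod_cast h
    · intro n hn
      simp only [Finset.mem_Ico] at hn
      exact ⟨n.toNat, by simp only [Finset.mem_Icc]; omega, by omega⟩
    · intro m _; simp
  rw [h2] at h1
  refine h1.trans (mul_le_mul_of_nonneg_left ?_ (by positivity))
  refine (weylIter_le hM hT j le_rfl _).trans (add_le_add_right (mul_le_mul_of_nonneg_left ?_
    (by positivity)) _)
  set c' := (j + 1).factorial * c with hc'
  have hc'0 : 0 < c' := Nat.mul_pos (Nat.factorial_pos _) hc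
  have hM0 : (0 : ℝ) < M := by exact_mod_cast hM
  have h3 := sum_weylKernel_le hq haq hα hM0 (c' * M ^ j)
  calc ∑ l ∈ Finset.Icc 1 (M ^ j), weylKernel M ((j + 1).factorial * f.coeff (j + 1) * l)
      = ∑ l ∈ (Finset.Icc 1 (M ^ j)).image (fun l => c' * l), weylKernel M (α * l) := by
        rw [Finset.sum_image fun x _ y _ h => Nat.eq_of_mul_eq_mul_left hc'0 h]
        refine Finset.sum_congr rfl fun l _ => ?_
        rw [hfc, hc']
        push_cast
        ring_nf
    _ ≤ ∑ l ∈ Finset.Icc 1 (c' * M ^ j), weylKernel M (α * l) := by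
        refine Finset.sum_le_sum_of_subset_of_nonneg ?_
          fun _ _ _ => weylKernel_nonneg hM0.le _
        intro x hx
        simp only [Finset.mem_image, Finset.mem_Icc] at hx ⊢
        obtain ⟨l, hl, rfl⟩ := hx
        exact ⟨Nat.mul_pos hc'0 hl.1, Nat.mul_le_mul_left _ hl.2⟩
    _ ≤ _ := by
        rw [hc'] at h3
        push_cast at h3
        exact h3

/-- Here `D` plays the role of `d²` and `R = √N`. From `MD ≤ N`, `D^(j+1) M^j ≤ D N^j`; the surplus
`D` is absorbed by the last factor, through `MD ≤ N ≤ Rq` and `Dq ≤ Rq`. The net saving is `R`. -/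
lemma weyl_numeric_bound {M j q D F : ℕ} (hj : 1 ≤ j) {N R T : ℝ} (hR : R ^ 2 = N) (hR1 : 1 ≤ R)
    (hT : 1 ≤ T) (hD1 : 1 ≤ D) (hDR : (D : ℝ) ≤ R) (hMD : (M : ℝ) * D ≤ N) (hqR : R ≤ q)
    (hqN : (q : ℝ) ≤ N) :
    (2 * M : ℝ) ^ (2 ^ j - (j + 1)) * (j * (2 * M : ℝ) ^ j + (2 * T) ^ j *
        ((F * (D : ℝ) ^ (j + 1) * (M : ℝ) ^ j / q + 1) * (6 * M + q * (1 + Real.log q)))) ≤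
      2 ^ 2 ^ j * (j + 2 ^ j * (7 * (F + 1))) * (T ^ j * (1 + Real.log N) * (N ^ 2 ^ j / R)) := by
  have hR0 : 0 < R := by linarith
  have hN1 : 1 ≤ N := by nlinarith
  have hq0 : (0 : ℝ) < q := by linarith
  have hD1' : (1 : ℝ) ≤ D := by exact_mod_cast hD1
  have hM0 : (0 : ℝ) ≤ M := Nat.cast_nonneg M
  have hMN : (M : ℝ) ≤ N := by nlinarith
  have hjp : j + 1 ≤ 2 ^ j := Nat.lt_two_pow_self
  have hlog : 0 ≤ Real.log N := Real.log_nonneg hN1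
  have hlogq : Real.log q ≤ Real.log N := Real.log_le_log hq0 hqN
  have hlogq0 : 0 ≤ Real.log q := Real.log_natCast_nonneg q
  have hRN : R ≤ N := by nlinarith
  have hTj : 1 ≤ T ^ j := one_le_pow₀ hT
  have e1 : N ^ 2 ^ j / R = N ^ (2 ^ j - (j + 1)) * (N ^ j * R) := by
    have : N ^ 2 ^ j = N ^ (2 ^ j - (j + 1)) * (N ^ j * N) := by
      rw [← pow_succ, ← pow_add]
      congr 1; omega
    rw [this, div_eq_iff hR0.ne']
    rw [← hR]; ring
  have hNj : N ≤ N ^ j := le_self_pow₀ hN1 (by omega)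
  have t1 : (j : ℝ) * (2 * M : ℝ) ^ j ≤ 2 ^ j * j * (N ^ j * R) := by
    have : (M : ℝ) ^ j ≤ N ^ j * R := by
      have : (M : ℝ) ^ j ≤ N ^ j := pow_le_pow_left₀ hM0 hMN j
      have h0 : 0 ≤ N ^ j := by positivity
      nlinarith
    rw [mul_pow]
    have := mul_le_mul_of_nonneg_left this (show (0 : ℝ) ≤ 2 ^ j * j by positivity)
    linarith
  have t2 : (F * (D : ℝ) ^ (j + 1) * (M : ℝ) ^ j / q + 1) ≤ (F + 1) * (D * N ^ j) / q := by
    rw [div_add_one hq0.ne', div_le_div_iff_of_pos_right hq0]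
    have h1 : (D : ℝ) ^ (j + 1) * (M : ℝ) ^ j ≤ D * N ^ j := by
      have : (D : ℝ) ^ (j + 1) * (M : ℝ) ^ j = D * (M * D) ^ j := by rw [mul_pow]; ring
      rw [this]
      gcongr
    have h2 : (q : ℝ) ≤ D * N ^ j := by nlinarith
    have h3 := mul_le_mul_of_nonneg_left h1 (Nat.cast_nonneg (α := ℝ) F)
    linarith
  have t3 : D * (6 * M + q * (1 + Real.log q)) ≤ 7 * (1 + Real.log N) * R * q := by
    have h1 : (M : ℝ) * D ≤ R * q := by nlinarith
    have h2 : (D : ℝ) * q * (1 + Real.log q) ≤ R * q * (1 + Real.log N) := by gcongr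
    have h3 : 0 ≤ R * q * Real.log N := by positivity
    nlinarith
  have t4 : (F * (D : ℝ) ^ (j + 1) * (M : ℝ) ^ j / q + 1) * (6 * M + q * (1 + Real.log q)) ≤
      7 * (F + 1) * (1 + Real.log N) * (N ^ j * R) := by
    calc _ ≤ (F + 1) * (D * N ^ j) / q * (6 * M + q * (1 + Real.log q)) := by gcongr
      _ = (F + 1) * N ^ j / q * (D * (6 * M + q * (1 + Real.log q))) := by ring
      _ ≤ (F + 1) * N ^ j / q * (7 * (1 + Real.log N) * R * q) := by gcongr
      _ = _ := by field_simp
  have t5 : (2 * M : ℝ) ^ (2 ^ j - (j + 1)) ≤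
      2 ^ (2 ^ j - (j + 1)) * N ^ (2 ^ j - (j + 1)) := by
    rw [mul_pow]; gcongr
  have t6 : (j : ℝ) * (2 * M : ℝ) ^ j + (2 * T) ^ j *
      ((F * (D : ℝ) ^ (j + 1) * (M : ℝ) ^ j / q + 1) * (6 * M + q * (1 + Real.log q))) ≤
      2 ^ j * (j + 2 ^ j * (7 * (F + 1))) * (T ^ j * (1 + Real.log N) * (N ^ j * R)) := by
    have hB : 0 ≤ N ^ j * R := by positivity
    have hA : 1 ≤ T ^ j * (1 + Real.log N) := by nlinarith
    have h1 : 2 ^ j * (j : ℝ) * (N ^ j * R) ≤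
        2 ^ j * (j : ℝ) * (T ^ j * (1 + Real.log N) * (N ^ j * R)) :=
      mul_le_mul_of_nonneg_left (le_mul_of_one_le_left hB hA) (by positivity)
    have h2 := mul_le_mul_of_nonneg_left t4 (show 0 ≤ (2 * T) ^ j by positivity)
    have h3 : (2 * T) ^ j * (7 * (F + 1) * (1 + Real.log N) * (N ^ j * R)) ≤
        2 ^ j * (2 ^ j * (7 * (F + 1))) * (T ^ j * (1 + Real.log N) * (N ^ j * R)) := by
      have : (2 * T) ^ j * (7 * (F + 1) * (1 + Real.log N) * (N ^ j * R)) =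
        2 ^ j * (1 * (7 * (F + 1))) * (T ^ j * (1 + Real.log N) * (N ^ j * R)) := by
        rw [mul_pow]; ring
      rw [this]
      gcongr
      exact one_le_pow₀ one_le_two
    linarith
  have t7 : (2 : ℝ) ^ (2 ^ j - (j + 1)) * 2 ^ j ≤ 2 ^ 2 ^ j := by
    rw [← pow_add]
    exact pow_le_pow_right₀ one_le_two (by omega)
  calc _ ≤ (2 ^ (2 ^ j - (j + 1)) * N ^ (2 ^ j - (j + 1))) *
        (2 ^ j * (j + 2 ^ j * (7 * (F + 1))) * (T ^ j * (1 + Real.log N) * (N ^ j * R))) := by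
        refine mul_le_mul t5 t6 ?_ (by positivity)
        positivity
    _ = (2 ^ (2 ^ j - (j + 1)) * 2 ^ j) * ((j + 2 ^ j * (7 * (F + 1))) *
        (T ^ j * (1 + Real.log N) * (N ^ (2 ^ j - (j + 1)) * (N ^ j * R)))) := by ring
    _ ≤ 2 ^ 2 ^ j * ((j + 2 ^ j * (7 * (F + 1))) *
        (T ^ j * (1 + Real.log N) * (N ^ (2 ^ j - (j + 1)) * (N ^ j * R)))) := by gcongr
    _ = _ := by rw [e1]; ring

lemma one_add_log_le_rpow {δ : ℝ} (hδ : 0 < δ) {N : ℝ} (hN : 1 ≤ N) :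
    1 + Real.log N ≤ (1 + 1 / δ) * N ^ δ := by
  have h1 := Real.log_le_rpow_div (zero_le_one.trans hN) hδ
  have h2 := Real.one_le_rpow hN hδ.le
  rw [add_mul, one_mul, one_div_mul_eq_div]
  linarith

lemma exponential_sum_square_progression_le (j : ℕ) (hj : 1 ≤ j) (η : ℝ) (hη : 0 < η) :
    ∃ C : ℝ, 1 ≤ C ∧ ∀ N : ℝ, 1 ≤ N → ∀ f : Polynomial ℝ, f.natDegree ≤ j + 1 →
      ∀ (a : ℤ) (q : ℕ), IsCoprime a (q : ℤ) → N ^ (1 / 2 : ℝ) ≤ q → (q : ℝ) ≤ N →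
      |f.coeff (j + 1) - a / q| ≤ 1 / (q : ℝ) ^ 2 →
      ∀ d : ℕ, 1 ≤ d → (d : ℝ) ^ 2 ≤ N ^ (1 / 2 : ℝ) →
      ‖∑ m ∈ Finset.Icc 1 (⌊N⌋₊ / d ^ 2), expE (f.eval (((d ^ 2 * m : ℕ)) : ℝ))‖ ≤
        C * N ^ (1 - 1 / (2 * (2 : ℝ) ^ j) + η) := by
  -- `T^j` costs `N^(j²δ)` and the logarithm one more `N^δ`, in total `N^η`.
  set δ : ℝ := η / (j ^ 2 + 1) with hδdef
  have hδ : 0 < δ := by positivity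
  obtain ⟨A, hA1, hA⟩ := card_divisors_le_rpow δ hδ
  set C₀ : ℝ := 2 ^ 2 ^ j * (j + 2 ^ j * (7 * ((j + 1).factorial + 1))) *
    (A ^ j * (1 + 1 / δ)) with hC₀
  have hC₀0 : 0 ≤ C₀ := by positivity
  refine ⟨1 + C₀, by linarith, ?_⟩
  intro N hN f hf a q haq hqR hqN hα d hd hdR
  have hN0 : 0 < N := by linarith
  set R : ℝ := N ^ (1 / 2 : ℝ) with hRdef
  have hR : R ^ 2 = N := by
    rw [hRdef, ← Real.rpow_natCast, ← Real.rpow_mul hN0.le]; norm_num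
  have hR1 : 1 ≤ R := Real.one_le_rpow hN (by norm_num)
  set M := ⌊N⌋₊ / d ^ 2 with hM
  have hNfl : (⌊N⌋₊ : ℝ) ≤ N := Nat.floor_le hN0.le
  have hM1 : 1 ≤ M := by
    rw [hM, Nat.one_le_div_iff (by positivity)]
    refine Nat.le_floor ?_
    push_cast
    nlinarith
  have hMd : (M : ℝ) * ((d ^ 2 : ℕ) : ℝ) ≤ N := by
    have : M * d ^ 2 ≤ ⌊N⌋₊ := Nat.div_mul_le_self _ _
    exact le_trans (by exact_mod_cast this) hNfl
  have hMN : (M : ℝ) ≤ N := le_trans (by exact_mod_cast Nat.div_le_self _ _) hNfl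
  have hq1 : 1 ≤ q := by
    have : (1 : ℝ) ≤ q := hR1.trans hqR
    exact_mod_cast this
  set T : ℝ := A * N ^ (j * δ) with hT
  have hTb : ∀ l : ℕ, l ≠ 0 → l ≤ M ^ j → (l.divisors.card : ℝ) ≤ T := by
    intro l hl hlM
    refine (hA l hl).trans (mul_le_mul_of_nonneg_left ?_ (by linarith))
    have : (l : ℝ) ≤ N ^ j :=
      le_trans (by exact_mod_cast hlM) (pow_le_pow_left₀ (by positivity) hMN j)
    rw [Real.rpow_mul hN0.le, Real.rpow_natCast]
    exact Real.rpow_le_rpow (by positivity) this hδ.le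
  have hT1 : 1 ≤ T := by simpa using hTb 1 one_ne_zero (Nat.one_le_pow _ _ hM1)
  set g := f.comp (Polynomial.C ((d : ℝ) ^ 2) * Polynomial.X) with hg
  have hgdeg : g.natDegree ≤ j + 1 := by
    refine (Polynomial.natDegree_comp_le).trans ?_
    calc _ ≤ f.natDegree * 1 := Nat.mul_le_mul_left _ 
          ((Polynomial.natDegree_C_mul_le _ _).trans Polynomial.natDegree_X_le)
      _ ≤ j + 1 := by omega
  have hgc : g.coeff (j + 1) = f.coeff (j + 1) * (((d ^ 2) ^ (j + 1) : ℕ) : ℝ) := by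
    rw [hg, Polynomial.comp_C_mul_X_coeff]
    push_cast
    ring
  have h1 := weyl_inequality_divisor_form hM1 hTb hgdeg (by positivity) hgc hq1 haq hα
  have h2 := weyl_numeric_bound (M := M) (D := d ^ 2) (F := (j + 1).factorial) hj hR hR1 hT1
    (Nat.one_le_pow _ _ hd) (by push_cast; exact hdR) hMd hqR hqN
  have h3 : ∀ m : ℕ, g.eval (m : ℝ) = f.eval (((d ^ 2 * m : ℕ)) : ℝ) := by
    intro m
    rw [hg, Polynomial.eval_comp]
    simp
  simp only [h3] at h1
  have h4 : T ^ j * (1 + Real.log N) ≤ A ^ j * (1 + 1 / δ) * N ^ η := by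
    have h5 : T ^ j = A ^ j * N ^ (j ^ 2 * δ) := by
      rw [hT, mul_pow, ← Real.rpow_natCast (N ^ (j * δ)), ← Real.rpow_mul hN0.le]
      ring_nf
    have h6 : N ^ η = N ^ (j ^ 2 * δ) * N ^ δ := by
      rw [← Real.rpow_add hN0]
      congr 1
      rw [hδdef]; field_simp
    rw [h5, h6]
    calc _ ≤ A ^ j * N ^ (j ^ 2 * δ) * ((1 + 1 / δ) * N ^ δ) := by
          gcongr; exact one_add_log_le_rpow hδ hN
      _ = _ := by ring
  set K : ℝ := (2 : ℝ) ^ j with hK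
  have hK1 : 1 ≤ K := one_le_pow₀ one_le_two
  have h7 : ‖∑ m ∈ Finset.Icc 1 M, expE (f.eval (((d ^ 2 * m : ℕ)) : ℝ))‖ ^ 2 ^ j ≤
      C₀ * N ^ (K - 1 / 2 + η) := by
    have e : N ^ 2 ^ j / R = N ^ (K - 1 / 2) := by
      rw [Real.rpow_sub hN0, ← Real.rpow_natCast N, hK]
      push_cast
      rfl
    rw [e] at h2
    push_cast at h1 h2 ⊢
    refine (h1.trans h2).trans ?_
    calc _ ≤ 2 ^ 2 ^ j * (j + 2 ^ j * (7 * (((j + 1).factorial : ℝ) + 1))) *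
          (A ^ j * (1 + 1 / δ) * N ^ η * N ^ (K - 1 / 2)) := by gcongr
      _ = _ := by rw [hC₀, Real.rpow_add hN0 (K - 1 / 2)]; ring
  -- The base `1 + C₀ ≥ 1` makes its `2^j`-th power dominate `C₀`; `K ≥ 1` gives `η ≤ ηK` in the
  -- exponent.
  have h8 : C₀ * N ^ (K - 1 / 2 + η) ≤ ((1 + C₀) * N ^ (1 - 1 / (2 * K) + η)) ^ 2 ^ j := by
    rw [mul_pow]
    gcongr
    · exact (by linarith : C₀ ≤ 1 + C₀).trans (le_self_pow₀ (by linarith) (by positivity))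
    · rw [← Real.rpow_natCast (N ^ (1 - 1 / (2 * K) + η)), ← Real.rpow_mul hN0.le]
      refine Real.rpow_le_rpow_of_exponent_le hN ?_
      push_cast
      rw [← hK]
      have : (1 - 1 / (2 * K) + η) * K = K - 1 / 2 + η * K := by field_simp
      rw [this]
      nlinarith
  exact le_of_pow_le_pow_left₀ (by positivity) (by positivity) (h7.trans h8)

/-! ### Minor arcs and the splitting of the squarefree sum -/

lemma exists_rat_approx_of_mem_minorArc {α N : ℝ} (hN : 1 ≤ N)
    (hα : α ∈ minorArc N (N ^ (1 / 2 : ℝ))) :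
    ∃ (a : ℤ) (q : ℕ), IsCoprime a (q : ℤ) ∧ N ^ (1 / 2 : ℝ) ≤ q ∧ (q : ℝ) ≤ N ∧
      |α - a / q| ≤ 1 / (q : ℝ) ^ 2 := by
  have hfl : 0 < ⌊N⌋₊ := Nat.floor_pos.2 hN
  obtain ⟨r, hr, hden⟩ := Real.exists_rat_abs_sub_le_and_den_le α hfl
  have hq0 : (0 : ℝ) < r.den := by exact_mod_cast r.pos
  have hqN : (r.den : ℝ) ≤ N :=
    le_trans (by exact_mod_cast hden) (Nat.floor_le (by linarith))
  have hr' : |α - (r.num : ℝ) / (r.den : ℝ)| ≤ 1 / ((r.den : ℝ) * N) := by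
    rw [← Rat.cast_def]
    refine hr.trans (one_div_le_one_div_of_le (by positivity) ?_)
    rw [mul_comm]
    exact mul_le_mul_of_nonneg_right (Nat.lt_floor_add_one N).le hq0.le
  have hco : IsCoprime r.num (r.den : ℤ) := by
    rw [Int.isCoprime_iff_gcd_eq_one]
    exact r.reduced
  refine ⟨r.num, r.den, hco, ?_, hqN, hr'.trans ?_⟩
  -- A denominator below `N^(1/2)` would put `α` in the major arcs.
  · by_contra h
    exact hα.2 ⟨r.num, r.den, r.pos, (not_le.1 h).le, hco, hr'⟩
  · rw [sq]
    exact one_div_le_one_div_of_le (by positivity) (mul_le_mul_of_nonneg_left hqN hq0.le)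

lemma squarefreeExpSum_eq (f : Polynomial ℝ) (N : ℝ) :
    squarefreeExpSum f N = ∑ d ∈ Finset.Icc 1 ⌊N⌋₊, (ArithmeticFunction.moebius d : ℂ) *
      ∑ m ∈ Finset.Icc 1 (⌊N⌋₊ / d ^ 2), expE (f.eval (((d ^ 2 * m : ℕ)) : ℝ)) := by
  rw [squarefreeExpSum]
  set n₀ := ⌊N⌋₊
  have h1 : ∀ n ∈ Finset.Icc 1 n₀,
      (((ArithmeticFunction.moebius n) ^ 2 : ℤ) : ℂ) * expE (f.eval (n : ℝ)) =
      ∑ d ∈ Finset.Icc 1 n₀, if d ^ 2 ∣ n then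
        (ArithmeticFunction.moebius d : ℂ) * expE (f.eval (n : ℝ)) else 0 := by
    intro n hn
    rw [Finset.mem_Icc] at hn
    rw [← sum_moebius_sq_dvd (N := n₀) (by omega) hn.2, ← Finset.sum_filter, ← Finset.sum_mul]
    push_cast
    rfl
  rw [Finset.sum_congr rfl h1, Finset.sum_comm]
  refine Finset.sum_congr rfl fun d hd => ?_
  rw [Finset.mem_Icc] at hd
  have hd2 : 0 < d ^ 2 := by have := hd.1; positivity
  rw [← Finset.sum_filter, ← Finset.mul_sum]
  congr 1
  refine (Finset.sum_bij (fun m _ => d ^ 2 * m) ?_ ?_ ?_ ?_).symm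
  · intro m hm
    simp only [Finset.mem_filter, Finset.mem_Icc] at hm ⊢
    refine ⟨⟨Nat.mul_pos hd2 hm.1, ?_⟩, dvd_mul_right _ _⟩
    have := (Nat.le_div_iff_mul_le hd2).1 hm.2
    linarith
  · intro m _ m' _ h
    exact Nat.eq_of_mul_eq_mul_left hd2 h
  · intro n hn
    simp only [Finset.mem_filter, Finset.mem_Icc] at hn
    obtain ⟨⟨hn1, hn2⟩, m, rfl⟩ := hn
    refine ⟨m, ?_, rfl⟩
    rw [Finset.mem_Icc, Nat.le_div_iff_mul_le hd2]
    exact ⟨Nat.pos_of_mul_pos_left hn1, by linarith⟩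
  · intro m _; rfl

lemma norm_squarefreeExpSum_le (f : Polynomial ℝ) {N : ℝ} (hN : 0 ≤ N) (D : ℕ) :
    ‖squarefreeExpSum f N‖ ≤ (∑ d ∈ Finset.Icc 1 D,
      ‖∑ m ∈ Finset.Icc 1 (⌊N⌋₊ / d ^ 2), expE (f.eval (((d ^ 2 * m : ℕ)) : ℝ))‖) +
        N * (2 / (D + 1)) := by
  have hμ : ∀ d : ℕ, ‖(ArithmeticFunction.moebius d : ℂ)‖ ≤ 1 := by
    intro d
    rw [Complex.norm_intCast]
    exact_mod_cast ArithmeticFunction.abs_moebius_le_one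
  set S : ℕ → ℝ := fun d =>
    ‖∑ m ∈ Finset.Icc 1 (⌊N⌋₊ / d ^ 2), expE (f.eval (((d ^ 2 * m : ℕ)) : ℝ))‖ with hS
  have h1 : ‖squarefreeExpSum f N‖ ≤ ∑ d ∈ Finset.Icc 1 ⌊N⌋₊, S d := by
    rw [squarefreeExpSum_eq]
    refine (norm_sum_le _ _).trans (Finset.sum_le_sum fun d _ => ?_)
    rw [norm_mul]
    exact mul_le_of_le_one_left (norm_nonneg _) (hμ d)
  have h2 : ∀ d, S d ≤ N * ((d : ℝ) ^ 2)⁻¹ := by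
    intro d
    refine (norm_sum_le _ _).trans ?_
    simp only [norm_expE, Finset.sum_const, Nat.card_Icc, nsmul_eq_mul, mul_one,
      Nat.add_sub_cancel]
    refine Nat.cast_div_le.trans ?_
    rw [div_eq_mul_inv]
    push_cast
    exact mul_le_mul_of_nonneg_right (Nat.floor_le hN) (by positivity)
  have h3 : Finset.Icc 1 ⌊N⌋₊ ⊆ Finset.Icc 1 D ∪ Finset.Ioo D (⌊N⌋₊ + 1) := by
    intro d
    simp only [Finset.mem_union, Finset.mem_Icc, Finset.mem_Ioo]
    omega
  have h4 : Disjoint (Finset.Icc 1 D) (Finset.Ioo D (⌊N⌋₊ + 1)) := by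
    rw [Finset.disjoint_left]
    intro d
    simp only [Finset.mem_Icc, Finset.mem_Ioo]
    omega
  calc ‖squarefreeExpSum f N‖ ≤ ∑ d ∈ Finset.Icc 1 ⌊N⌋₊, S d := h1
    _ ≤ ∑ d ∈ Finset.Icc 1 D ∪ Finset.Ioo D (⌊N⌋₊ + 1), S d :=
        Finset.sum_le_sum_of_subset_of_nonneg h3 fun _ _ _ => norm_nonneg _
    _ = ∑ d ∈ Finset.Icc 1 D, S d + ∑ d ∈ Finset.Ioo D (⌊N⌋₊ + 1), S d :=
        Finset.sum_union h4
    _ ≤ ∑ d ∈ Finset.Icc 1 D, S d + N * (2 / (D + 1)) := by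
        refine add_le_add_right ?_ _
        refine (Finset.sum_le_sum fun d _ => h2 d).trans ?_
        rw [← Finset.mul_sum]
        exact mul_le_mul_of_nonneg_left (sum_Ioo_inv_sq_le D _) hN

lemma norm_squarefreeExpSum_le_self (f : Polynomial ℝ) {N : ℝ} (hN : 0 ≤ N) :
    ‖squarefreeExpSum f N‖ ≤ N := by
  rw [squarefreeExpSum]
  refine (norm_sum_le_of_le (f := fun n : ℕ =>
    (((ArithmeticFunction.moebius n) ^ 2 : ℤ) : ℂ) * expE (f.eval (n : ℝ)))
    (n := fun _ => (1 : ℝ)) _ fun n _ => ?_).trans ?_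
  · rw [norm_mul, norm_expE, mul_one, ArithmeticFunction.moebius_sq]
    split_ifs <;> simp
  · simpa using Nat.floor_le hN

/-! ### Optimising the cut and uniformity in the degree -/

lemma weylGamma_add_one (j : ℕ) : weylGamma (j + 1) = 1 / ((2 : ℝ) ^ j) ^ 2 := by
  rw [weylGamma, ← pow_mul, mul_comm j 2, pow_mul]
  have : (1 : ℝ) - ((j + 1 : ℕ) : ℝ) = -(j : ℝ) := by push_cast; ring
  rw [this, Real.rpow_neg (by norm_num), Real.rpow_natCast, one_div]
  norm_num

lemma squarefreeExpSum_le_of_degree (ε : ℝ) (hε : 0 < ε) (k : ℕ) (hk : 2 ≤ k) :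
    ∃ C : ℝ, 0 ≤ C ∧ ∀ f : Polynomial ℝ, f.natDegree = k → ∀ N : ℝ, 1 ≤ N →
      f.leadingCoeff ∈ minorArc N (N ^ (1 / 2 : ℝ)) →
        ‖squarefreeExpSum f N‖ ≤ C * N ^ (1 + ε - weylGamma k / 2) := by
  obtain ⟨j, rfl⟩ : ∃ j, k = j + 1 := ⟨k - 1, by omega⟩
  obtain ⟨C, hC1, hC⟩ := exponential_sum_square_progression_le j (by omega) ε hε
  refine ⟨C + 2, by linarith, ?_⟩
  intro f hf N hN hα
  rw [Polynomial.leadingCoeff, hf] at hα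
  obtain ⟨a, q, haq, hqR, hqN, happ⟩ := exists_rat_approx_of_mem_minorArc hN hα
  have hN0 : 0 < N := by linarith
  set K : ℝ := (2 : ℝ) ^ j with hK
  have hK2 : 2 ≤ K := by
    calc (2 : ℝ) = 2 ^ 1 := (pow_one 2).symm
      _ ≤ 2 ^ j := pow_le_pow_right₀ one_le_two (by omega)
  set γ := weylGamma (j + 1) with hγ
  have hγK : γ = 1 / K ^ 2 := weylGamma_add_one j
  have hγle : γ ≤ 1 / (2 * K) := by
    rw [hγK]
    exact one_div_le_one_div_of_le (by positivity) (by nlinarith)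
  have hγ4 : γ ≤ 1 / 4 := by
    rw [hγK]
    exact one_div_le_one_div_of_le (by norm_num) (by nlinarith)
  -- The tail `N/Y` then meets the target exactly, and the head needs only `γ ≤ 1/(2K)`. The bound
  -- `γ ≤ 1/4` ensures `d² ≤ N^(1/2)` for all `d ≤ Y`.
  set Y := N ^ (γ / 2) with hY
  have hY0 : 0 < Y := Real.rpow_pos_of_pos hN0 _
  have hYN : Y ^ 2 ≤ N ^ (1 / 2 : ℝ) := by
    rw [hY, ← Real.rpow_natCast, ← Real.rpow_mul hN0.le]
    refine Real.rpow_le_rpow_of_exponent_le hN ?_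
    push_cast
    linarith
  have h1 := norm_squarefreeExpSum_le f hN0.le ⌊Y⌋₊
  have h2 : ∑ d ∈ Finset.Icc 1 ⌊Y⌋₊,
      ‖∑ m ∈ Finset.Icc 1 (⌊N⌋₊ / d ^ 2), expE (f.eval (((d ^ 2 * m : ℕ)) : ℝ))‖ ≤
      Y * (C * N ^ (1 - 1 / (2 * K) + ε)) := by
    refine (Finset.sum_le_card_nsmul _ _ (C * N ^ (1 - 1 / (2 * K) + ε)) fun d hd => ?_).trans ?_
    · rw [Finset.mem_Icc] at hd
      have hdY : (d : ℝ) ≤ Y :=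
        le_trans (by exact_mod_cast hd.2) (Nat.floor_le hY0.le)
      exact hC N hN f hf.le a q haq hqR hqN happ d hd.1
        ((pow_le_pow_left₀ (by positivity) hdY 2).trans hYN)
    · rw [nsmul_eq_mul, Nat.card_Icc, Nat.add_sub_cancel]
      exact mul_le_mul_of_nonneg_right (Nat.floor_le hY0.le) (by positivity)
  have h3 : Y * (C * N ^ (1 - 1 / (2 * K) + ε)) ≤ C * N ^ (1 + ε - γ / 2) := by
    rw [mul_left_comm, hY, ← Real.rpow_add hN0]
    refine mul_le_mul_of_nonneg_left (Real.rpow_le_rpow_of_exponent_le hN ?_) (by linarith)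
    linarith
  have h4 : N * (2 / (⌊Y⌋₊ + 1)) ≤ 2 * N ^ (1 + ε - γ / 2) := by
    calc N * (2 / (⌊Y⌋₊ + 1)) ≤ N * (2 / Y) := by
          gcongr
          exact (Nat.lt_floor_add_one Y).le
      _ = 2 * N ^ (1 - γ / 2) := by
          rw [Real.rpow_sub hN0, Real.rpow_one, hY]; ring
      _ ≤ _ := by
          refine mul_le_mul_of_nonneg_left (Real.rpow_le_rpow_of_exponent_le hN ?_) two_pos.le
          linarith
  linarith

theorem mainTheorem6 (ε : ℝ) (hε : 0 < ε) :
    ∃ C : ℝ, 0 < C ∧ ∀ (k : ℕ), 2 ≤ k → ∀ (f : Polynomial ℝ), f.natDegree = k →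
      ∀ N : ℝ, 1 ≤ N → f.leadingCoeff ∈ minorArc N (N ^ (1 / 2 : ℝ)) →
        ‖squarefreeExpSum f N‖ ≤ C * N ^ (1 + ε - weylGamma k / 2) := by
  have hex : ∀ k : ℕ, ∃ C : ℝ, 0 ≤ C ∧ (2 ≤ k → ∀ f : Polynomial ℝ, f.natDegree = k →
      ∀ N : ℝ, 1 ≤ N → f.leadingCoeff ∈ minorArc N (N ^ (1 / 2 : ℝ)) →
        ‖squarefreeExpSum f N‖ ≤ C * N ^ (1 + ε - weylGamma k / 2)) := by
    intro k
    by_cases hk : 2 ≤ k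
    · obtain ⟨C, hC0, hC⟩ := squarefreeExpSum_le_of_degree ε hε k hk
      exact ⟨C, hC0, fun _ => hC⟩
    · exact ⟨0, le_rfl, fun h => absurd h hk⟩
  choose C hC0 hC using hex
  -- For `k ≥ k₀`, `2^(k-1) ≥ k > 1/ε` forces `γ/2 ≤ ε`, so the target is at least `N`. The
  -- constants for `k < k₀` are summed.
  obtain ⟨k₀, hk₀⟩ := exists_nat_gt (1 / ε)
  have hsum : 0 ≤ ∑ k ∈ Finset.range k₀, C k := Finset.sum_nonneg fun k _ => hC0 k
  refine ⟨1 + ∑ k ∈ Finset.range k₀, C k, by linarith, ?_⟩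
  intro k hk f hf N hN hα
  have hN0 : 0 < N := by linarith
  rcases lt_or_ge k k₀ with hlt | hge
  · refine (hC k hk f hf N hN hα).trans (mul_le_mul_of_nonneg_right ?_ (by positivity))
    have := Finset.single_le_sum (f := C) (fun i _ => hC0 i) (Finset.mem_range.2 hlt)
    linarith
  · have hγ : weylGamma k / 2 ≤ ε := by
      obtain ⟨j, rfl⟩ : ∃ j, k = j + 1 := ⟨k - 1, by omega⟩
      have h1 : ((j + 1 : ℕ) : ℝ) ≤ 2 ^ j := by exact_mod_cast Nat.lt_two_pow_self (n := j)
      have h2 : 1 / ε < 2 ^ j := hk₀.trans_le (le_trans (by exact_mod_cast hge) h1)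
      have h3 : 1 ≤ (2 : ℝ) ^ j := one_le_pow₀ one_le_two
      rw [weylGamma_add_one, div_div, div_le_iff₀ (by positivity)]
      rw [div_lt_iff₀ hε] at h2
      nlinarith [mul_le_mul_of_nonneg_left h3 (by positivity : (0 : ℝ) ≤ ε * 2 ^ j)]
    calc ‖squarefreeExpSum f N‖ ≤ N := norm_squarefreeExpSum_le_self f hN0.le
      _ = N ^ (1 : ℝ) := (Real.rpow_one N).symm
      _ ≤ N ^ (1 + ε - weylGamma k / 2) :=
          Real.rpow_le_rpow_of_exponent_le hN (by linarith)
      _ ≤ _ := le_mul_of_one_le_left (by positivity) (by linarith)
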